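/- **Setting.** An electrical circuit is given by a finite connected graph $G$ with $n$ vertices and oriented edges (parallel edges allowed, no loops). Each edge is a voltage source, a capacitor, a dissipator, an inductor or a current source; let $\mathbf V,\mathbf C,\mathbf D,\mathbf L,\mathbf I$ be the corresponding edge sets. Let $A$ be the oriented incidence matrix, with columns $a_e$, and for a set $S$ of edges let $A_S$ be the submatrix of the columns in $S$. Let $\mathtt T$ be a spanning tree of $G$ with cotree $\mathtt T^*$, and let $F$ (rows indexed by $\mathtt T^*$, columns by $\mathtt T$) be the matrix with $a_r=-\sum_{s\in\mathtt T}F_{rs}a_s$ for all $r\in\mathtt T^*$. Let $\mathbb T\subset\mathbb R$ be an interval with nonempty interior. A square matrix $M$ is called positive definite if $y^{\top}My>0$ for all $y\ne0$ (no symmetry is required). Assume: * (M2-1) (A1) No cycle consists of voltage sources only. (A2) No cutset consists of current sources only. (A3) $\mathtt T$ is normal: it contains all of $\mathbf V$, none of $\mathbf I$, and exactly $r_{VC}-r_V$ capacitors, $r_{VCD}-r_{VC}$ dissipators and $r_{VCDL}-r_{VCD}$ inductors, where $r_V,r_{VC},r_{VCD},r_{VCDL}$ are the ranks of $A_{\mathbf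 V}$, $A_{\mathbf V\cup\mathbf C}$, $A_{\mathbf V\cup\mathbf C\cup\mathbf D}$, $A_{\mathbf V\cup\mathbf C\cup\mathbf D\cup\mathbf L}$. (A4), (A5) The energy is $\mathcal H(q,\varphi)=\mathcal H_{\mathbf C}(q)+\mathcal H_{\mathbf L}(\varphi)$, twice continuously differentiable on $\mathbb R^{\mathbf C}\times\mathbb R^{\mathbf L}$, and the Hessians of $\mathcal H_{\mathbf C}$ and $\mathcal H_{\mathbf L}$ are positive definite at every point. (A6) The currents $\iota_{\mathbf D}$ and voltages $\nu_{\mathbf D}$ of the dissipators satisfy $r(\iota_{\mathbf D},\nu_{\mathbf D})=0$ with $r:\mathbb R^{\mathbf D}\times\mathbb R^{\mathbf D}\to\mathbb R^{\mathbf D}$ continuously differentiable, and at every zero of $r$ the pair $(B,B')=(\partial r/\partial\iota_{\mathbf D},\partial r/\partial\nu_{\mathbf D})$ is positive definite: $By+B'y'=0$ with $(y,y')\neq(0,0)$ implies $y^{\top}y'>0$. * (M2-2) The sources are independent: the voltages $V(t)$ of the voltage sources and the currents $I(t)$ of the current sources are given continuously differentiable functions of $t\in\mathbb T$. * (M2-3)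 $\mathbf D$ is split into disjoint sets $\mathbf R$, $\mathbf G$, and the dissipators are described by a mixed form $(\nu_{\mathbf R},\iota_{\mathbf G})=\rho(\iota_{\mathbf R},\nu_{\mathbf G})$, where $\rho$ is continuously differentiable on an open set $\Omega\subseteq\mathbb R^{\mathbf D}$ and, near each point $(\iota_{\mathbf D},\nu_{\mathbf D})$ that it gives, this equation is equivalent to $r(\iota_{\mathbf D},\nu_{\mathbf D})=0$. **Model 2 system.** The variables are $x=(q,\varphi,\hat x)$ with $q\in\mathbb R^{\mathbf C}$, $\varphi\in\mathbb R^{\mathbf L}$ and $\hat x=(\iota_{\mathbf R},\nu_{\mathbf G})\in\Omega$. Put $\iota_{\mathbf C}=\dot q$, $\nu_{\mathbf C}=\partial\mathcal H/\partial q$, $\iota_{\mathbf L}=\partial\mathcal H/\partial\varphi$, $\nu_{\mathbf L}=\dot\varphi$, obtain $\iota_{\mathbf D},\nu_{\mathbf D}$ from $\hat x$ and $\rho(\hat x)$, and put $\nu_{\mathbf V}=V(t)$, $\iota_{\mathbf I}=I(t)$. The system $0=f(t,x,\dot x)$ consists of Kirchhoff's laws $0=\iota_{\mathtt T}-F^{\top}\iota_{\mathtt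 T^*}$ and $0=\nu_{\mathtt T^*}+F\nu_{\mathtt T}$, in the rows of all edges that are not sources. **Index.** The system has index $\nu$ if the following holds. The function $f$ is $\nu$ times continuously differentiable. The equations $f=0$ and their total time derivatives up to order $\nu$, viewed as algebraic equations in $(t,x,\dot x,\dots,x^{(\nu+1)})$, have a solution, and there is a continuous function $\psi$ with $\dot x=\psi(t,x)$ at all their solutions. Finally, for no $k<\nu$ and no $(t,x)$ that belongs to such a solution do the equations with derivatives up to order $k$ determine $\dot x$ uniquely. **Theorem 4.8 (Model 2 index).** Let $n_C,n_D$ be the numbers of capacitors and dissipators in the cotree, and $n_l,n_d$ the numbers of inductors and dissipators in the tree. Under M2-1–M2-3: 1. If $n_C=n_l=n_d=n_D=0$, then the Model 2 system is an ODE: there is a continuous $g$ with $f(t,x,\dot x)=0\iff\dot x=g(t,x)$. 2. Otherwise, provided that $f(t,x,\dot x)=0$ holds for at least one $(t,x,\dot x)$, it is a DAE of index $1$. -/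

import Mathlib

open Set Topology

noncomputable section

/-! ### Differential-algebraic equations `0 = f (t, x, x')` and their differentiation index -/

namespace DAE

variable {X Y : Type*} [NormedAddCommGroup X] [NormedSpace ℝ X]
  [NormedAddCommGroup Y] [NormedSpace ℝ Y]

/-- The polynomial curve `s ↦ ∑_{m ≤ n} (s - t)^m / m! • ξ m`, whose derivatives of order
`0, …, n` at time `t` are the prescribed vectors `ξ 0, …, ξ n`. -/
def jetCurve (t : ℝ) (ξ : ℕ → X) (n : ℕ) (s : ℝ) : X :=
  ∑ m ∈ Finset.range (n + 1), ((s - t) ^ m / (m.factorial : ℝ)) • ξ m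

/-- The equations of the derivative array of order `k`, i.e. `f = 0, (d/dt) f = 0, …, (d/dt)^k f = 0`,
hold at the point `(t, x, x', …, x^(k+1)) = (t, ξ 0, ξ 1, …, ξ (k+1))`. By the chain rule the
`j`-th total time derivative of `f` at this point is the `j`-th derivative at time `t` of the
residual along a curve having these derivatives at `t`. Time is restricted to `I`. -/
def ArrayHolds (f : ℝ → X → X → Y) (I : Set ℝ) (k : ℕ) (t : ℝ) (ξ : ℕ → X) : Prop :=
  ∀ j ≤ k, iteratedDerivWithin j
    (fun s => f s (jetCurve t ξ (k + 1) s) (deriv (jetCurve t ξ (k + 1)) s)) I t = 0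

/-- The system `0 = f (t, x, x')`, for `t ∈ I` and `x ∈ U`, is an ordinary differential equation:
it says precisely `x' = g (t, x)`, for a continuous `g`. -/
def IsODE (f : ℝ → X → X → Y) (I : Set ℝ) (U : Set X) : Prop :=
  ∃ g : ℝ → X → X, ContinuousOn (fun z : ℝ × X => g z.1 z.2) (I ×ˢ U) ∧
    ∀ t ∈ I, ∀ x ∈ U, ∀ p : X, f t x p = 0 ↔ p = g t x

/-- The system `0 = f (t, x, x')`, for `t ∈ I` and `x ∈ U`, has differentiation index `ν`: the
equations and their total time derivatives up to order `ν` determine `x'` as a continuous function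
of `(t, x)`, and fewer differentiations do not suffice, at any consistent point. -/
structure HasDifferentiationIndex (f : ℝ → X → X → Y) (I : Set ℝ) (U : Set X) (ν : ℕ) : Prop where
  /-- the differentiations that the index calls for are legitimate -/
  smooth : ContDiffOn ℝ (ν : WithTop ℕ∞) (fun z : ℝ × X × X => f z.1 z.2.1 z.2.2)
    (I ×ˢ (U ×ˢ univ))
  /-- there are consistent points -/
  consistent : ∃ t ∈ I, ∃ ξ : ℕ → X, ξ 0 ∈ U ∧ ArrayHolds f I ν t ξ
  /-- `ν` differentiations give an ordinary differential equation `x' = ψ (t, x)` -/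
  solved : ∃ ψ : ℝ → X → X, ContinuousOn (fun z : ℝ × X => ψ z.1 z.2) (I ×ˢ U) ∧
    ∀ t ∈ I, ∀ ξ : ℕ → X, ξ 0 ∈ U → ArrayHolds f I ν t ξ → ξ 1 = ψ t (ξ 0)
  /-- fewer than `ν` differentiations leave `x'` undetermined, at each consistent `(t, x)` -/
  minimal : ∀ k < ν, ∀ t ∈ I, ∀ ξ : ℕ → X, ξ 0 ∈ U → ArrayHolds f I ν t ξ →
    ∃ η : ℕ → X, η 0 = ξ 0 ∧ ArrayHolds f I k t η ∧ η 1 ≠ ξ 1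

end DAE

/-! ### Positive definiteness (no symmetry is assumed) and derivatives on `ι → ℝ` -/

namespace CpH

/-- `M` is positive definite: `yᵀ M y > 0` for all `y ≠ 0`. -/
def IsPD {ι : Type*} [Fintype ι] (M : Matrix ι ι ℝ) : Prop :=
  ∀ y : ι → ℝ, y ≠ 0 → 0 < y ⬝ᵥ (M.mulVec y)

/-- `(B, B')` is a positive definite matrix pair. -/
def IsPDMP {ι : Type*} [Fintype ι] (B B' : Matrix ι ι ℝ) : Prop :=
  ∀ y y' : ι → ℝ, (y ≠ 0 ∨ y' ≠ 0) → B.mulVec y + B'.mulVec y' = 0 → 0 < y ⬝ᵥ y'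

/-- Partial derivative `∂H/∂x_j` at `x`. -/
def pderiv {ι : Type*} [Fintype ι] [DecidableEq ι] (H : (ι → ℝ) → ℝ) (x : ι → ℝ) (j : ι) : ℝ :=
  fderiv ℝ H x (Pi.single j 1)

/-- Hessian matrix `∂²H/∂x²` at `x`. -/
def hessian {ι : Type*} [Fintype ι] [DecidableEq ι] (H : (ι → ℝ) → ℝ) (x : ι → ℝ) :
    Matrix ι ι ℝ :=
  Matrix.of fun i j => pderiv (fun y => pderiv H y i) x j

/-- Jacobian matrix of `g` at `x`. -/
def jacobian {ι : Type*} [Fintype ι] [DecidableEq ι] (g : (ι → ℝ) → (ι → ℝ)) (x : ι → ℝ) :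
    Matrix ι ι ℝ :=
  Matrix.of fun i j => pderiv (fun y => g y i) x j

/-! ### Circuits -/

/-- The five kinds of circuit elements: voltage sources, capacitors, dissipators, inductors and
current sources. -/
inductive Kind where
  | vsrc | cap | diss | ind | isrc
  deriving DecidableEq

/-- An electrical circuit on the node set `V` with branch set `E`. Several edges between two
vertices are allowed, loops are not. The relation `dissRel ι ν = 0` between currents and voltages
describes the dissipators. The energies, and the dissipative relation, may couple all the elements
of the same group. -/
structure Circuit (V E : Type*) where
  /-- start vertex of an (oriented) edge -/
  src : E → V
  /-- end vertex of an (oriented) edge -/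
  tgt : E → V
  src_ne_tgt : ∀ e, src e ≠ tgt e
  kind : E → Kind
  /-- energy of the capacitors, as a function of their charges -/
  capEnergy : ({e // kind e = Kind.cap} → ℝ) → ℝ
  /-- energy of the inductors, as a function of their flux linkages -/
  indEnergy : ({e // kind e = Kind.ind} → ℝ) → ℝ
  /-- left-hand side of the constitutive relation of the dissipators, a function of currents and
  voltages -/
  dissRel : ({e // kind e = Kind.diss} → ℝ) → ({e // kind e = Kind.diss} → ℝ) →
    ({e // kind e = Kind.diss} → ℝ)
  /-- the given voltages of the voltage sources -/
  vSource : ℝ → {e // kind e = Kind.vsrc} → ℝ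
  /-- the given currents of the current sources -/
  iSource : ℝ → {e // kind e = Kind.isrc} → ℝ

namespace Circuit

variable {V E : Type*} (c : Circuit V E)

/-- The edges of a given kind. -/
abbrev Edge (k : Kind) : Type _ := {e : E // c.kind e = k}

/-- The edges that are not sources. -/
abbrev NonSource : Type _ := {e : E // c.kind e ≠ Kind.vsrc ∧ c.kind e ≠ Kind.isrc}

/-! #### Graph notions -/

/-- The edge `e` joins `u` and `w`, in either direction. -/
def Joins (e : E) (u w : V) : Prop :=
  (c.src e = u ∧ c.tgt e = w) ∨ (c.src e = w ∧ c.tgt e = u)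

/-- The subgraph with all the vertices and the edges in `S` is connected. -/
def IsSpanning (S : Set E) : Prop :=
  Nonempty V ∧ ∀ u w : V, Relation.ReflTransGen (fun a b => ∃ e ∈ S, c.Joins e a b) u w

/-- There is a cycle `v₀, e₀, v₁, e₁, …, v_l, e_l, v₀` with distinct vertices and distinct edges,
all edges being in `S`. (In `Fin (l + 1)` the successor of `l` is `0`.) -/
def HasCycle (S : Set E) : Prop :=
  ∃ (l : ℕ) (v : Fin (l + 1) → V) (e : Fin (l + 1) → E), Function.Injective v ∧
    Function.Injective e ∧ ∀ i, e i ∈ S ∧ c.Joins (e i) (v i) (v (i + 1))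

/-- There is a cutset, given by a partition of the vertices into two nonempty sides `W` and `Wᶜ`,
all of whose edges are in `S`. -/
def HasCutset (S : Set E) : Prop :=
  ∃ W : Set V, W.Nonempty ∧ Wᶜ.Nonempty ∧
    ∀ e, ¬ (c.src e ∈ W ↔ c.tgt e ∈ W) → e ∈ S

/-- `S` is (the edge set of) a spanning tree. -/
def IsTree (S : Set E) : Prop := c.IsSpanning S ∧ ¬ c.HasCycle S

variable [Fintype V] [DecidableEq V] [Fintype E] [DecidableEq E]

/-- The oriented incidence matrix. -/
def incidence : Matrix V E ℝ :=
  Matrix.of fun v e => if v = c.src e then 1 else if v = c.tgt e then -1 else 0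

/-- The rank of the columns of the incidence matrix that belong to edges of the kinds in `K`. -/
def rankOf (K : Finset Kind) : ℕ :=
  (c.incidence.submatrix id (fun e : {e : E // c.kind e ∈ K} => e.1)).rank

/-- The number of edges of kind `k` in the tree `T`. -/
def nTwig (T : Finset E) (k : Kind) : ℕ := (T.filter fun e => c.kind e = k).card

/-- The number of edges of kind `k` in the cotree of `T`. -/
def nLink (T : Finset E) (k : Kind) : ℕ := (Tᶜ.filter fun e => c.kind e = k).card

/-- `T` is a normal tree: it contains all the voltage sources, no current source, and
`r_VC - r_V` capacitors, `r_VCD - r_VC` dissipators, `r_VCDL - r_VCD` inductors, where the `r`'s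
are the ranks of the corresponding parts of the incidence matrix. -/
structure IsNormalTree (T : Finset E) : Prop where
  isTree : c.IsTree (T : Set E)
  vsrc : ∀ e, c.kind e = Kind.vsrc → e ∈ T
  cap : c.nTwig T Kind.cap + c.rankOf {Kind.vsrc} = c.rankOf {Kind.vsrc, Kind.cap}
  diss : c.nTwig T Kind.diss + c.rankOf {Kind.vsrc, Kind.cap}
    = c.rankOf {Kind.vsrc, Kind.cap, Kind.diss}
  ind : c.nTwig T Kind.ind + c.rankOf {Kind.vsrc, Kind.cap, Kind.diss}
    = c.rankOf {Kind.vsrc, Kind.cap, Kind.diss, Kind.ind}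
  isrc : ∀ e, c.kind e = Kind.isrc → e ∉ T

/-- The Kron (cycle-cutset) matrix `F` of the tree `T`. Rows belong to links, columns to twigs;
for a tree it is the unique matrix such that the columns `a_e` of the incidence matrix satisfy
`a_r = - ∑_s F r s • a_s` for each link `r`, with `s` running through the twigs. -/
def kron (T : Finset E) : Matrix {e : E // e ∉ T} {e : E // e ∈ T} ℝ :=
  Classical.epsilon fun F => ∀ (r : {e : E // e ∉ T}) (v : V),
    c.incidence v r = -∑ s : {e : E // e ∈ T}, F r s * c.incidence v s

/-- Residual at the edge `e` of Kirchhoff's laws for the tree `T`: the current law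
`i_T - Fᵀ i_N` of the fundamental cutset if `e` is a twig, the voltage law `v_N + F v_T` of the
fundamental cycle if `e` is a link. -/
def kirchhoff (T : Finset E) (i v : E → ℝ) (e : E) : ℝ :=
  if h : e ∈ T then i e - ∑ r : {e : E // e ∉ T}, c.kron T r ⟨e, h⟩ * i r
  else v e + ∑ s : {e : E // e ∈ T}, c.kron T ⟨e, h⟩ s * v s

/-! #### The dissipators in mixed form -/

/-- For a splitting of a finite set of dissipators into the set `G` and its complement, exchange
the `j`-th entries of `a` and `b` for `j ∈ G`, and return the vector that replaces `a`. Thus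
`mix G i v = (i_R, v_G)` and `mix G v i = (v_R, i_G)`, and conversely `mix G` recovers from
`a = (i_R, v_G)` and `b = (v_R, i_G)` the currents `mix G a b` and the voltages `mix G b a`. -/
def mix {δ : Type*} [DecidableEq δ] (G : Finset δ) (a b : δ → ℝ) : δ → ℝ :=
  fun j => if j ∈ G then b j else a j

/-- The dissipative structure is described by the mixed form `(v_R, i_G) = ρ (i_R, v_G)`, for
`(i_R, v_G)` in the open set `Ω`: a continuously differentiable `ρ` for which, near each
current-voltage pair that it gives, this equation is equivalent to the constitutive relation. -/
structure IsMixedForm (G : Finset (c.Edge Kind.diss)) (Ω : Set (c.Edge Kind.diss → ℝ))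
    (ρ : (c.Edge Kind.diss → ℝ) → (c.Edge Kind.diss → ℝ)) : Prop where
  isOpen : IsOpen Ω
  smooth : ContDiffOn ℝ 1 ρ Ω
  represents : ∀ y ∈ Ω, ∀ᶠ z in 𝓝 (mix G y (ρ y), mix G (ρ y) y),
    (c.dissRel z.1 z.2 = 0 ↔ mix G z.2 z.1 = ρ (mix G z.1 z.2))

/-! #### Standing assumptions -/

/-- The assumptions on the circuit and on the tree `T`. -/
structure Assumptions (T : Finset E) : Prop where
  connected : c.IsSpanning univ
  no_vsrc_cycle : ¬ c.HasCycle {e | c.kind e = Kind.vsrc}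
  no_isrc_cutset : ¬ c.HasCutset {e | c.kind e = Kind.isrc}
  normal : c.IsNormalTree T
  cap_smooth : ContDiff ℝ 2 c.capEnergy
  ind_smooth : ContDiff ℝ 2 c.indEnergy
  cap_hessian : ∀ q, IsPD (hessian c.capEnergy q)
  ind_hessian : ∀ φ, IsPD (hessian c.indEnergy φ)
  diss_smooth : ContDiff ℝ 1 fun z : (c.Edge Kind.diss → ℝ) × (c.Edge Kind.diss → ℝ) =>
    c.dissRel z.1 z.2
  diss_passive : ∀ i v, c.dissRel i v = 0 →
    IsPDMP (jacobian (fun i' => c.dissRel i' v) i) (jacobian (fun v' => c.dissRel i v') v)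

/-! #### The state equation -/

/-- The space of the variables `x = (q, φ, y)`: charges of the capacitors, flux linkages of the
inductors, and for each dissipator either its current or its voltage. -/
abbrev State : Type _ :=
  (c.Edge Kind.cap → ℝ) × (c.Edge Kind.ind → ℝ) × (c.Edge Kind.diss → ℝ)

/-- The currents as functions of `(t, x, x')`. The currents of the voltage sources are outputs.
If all the voltage sources are twigs then they do not occur in the state equation, and the value
given here is immaterial. -/
def current (G : Finset (c.Edge Kind.diss)) (ρ : (c.Edge Kind.diss → ℝ) → (c.Edge Kind.diss → ℝ))
    (t : ℝ) (x p : c.State) (e : E) : ℝ :=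
  match h : c.kind e with
  | Kind.vsrc => 0
  | Kind.cap => p.1 ⟨e, h⟩
  | Kind.diss => mix G x.2.2 (ρ x.2.2) ⟨e, h⟩
  | Kind.ind => pderiv c.indEnergy x.2.1 ⟨e, h⟩
  | Kind.isrc => c.iSource t ⟨e, h⟩

/-- The voltages as functions of `(t, x, x')`. The voltages of the current sources are outputs.
If all the current sources are links then they do not occur in the state equation, and the value
given here is immaterial. -/
def voltage (G : Finset (c.Edge Kind.diss)) (ρ : (c.Edge Kind.diss → ℝ) → (c.Edge Kind.diss → ℝ))
    (t : ℝ) (x p : c.State) (e : E) : ℝ :=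
  match h : c.kind e with
  | Kind.vsrc => c.vSource t ⟨e, h⟩
  | Kind.cap => pderiv c.capEnergy x.1 ⟨e, h⟩
  | Kind.diss => mix G (ρ x.2.2) x.2.2 ⟨e, h⟩
  | Kind.ind => p.2.1 ⟨e, h⟩
  | Kind.isrc => 0

/-- The residual `f (t, x, x')` of the state equation: Kirchhoff's laws for the tree `T`, in the
rows of all the edges that are not sources. -/
def stateEq (T : Finset E) (G : Finset (c.Edge Kind.diss))
    (ρ : (c.Edge Kind.diss → ℝ) → (c.Edge Kind.diss → ℝ)) (t : ℝ) (x p : c.State) :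
    c.NonSource → ℝ :=
  fun e => c.kirchhoff T (c.current G ρ t x p) (c.voltage G ρ t x p) e

/-- The set of admissible `x = (q, φ, y)`: the mixed form has to be defined at `y`. -/
def stateDomain (Ω : Set (c.Edge Kind.diss → ℝ)) : Set c.State := {x | x.2.2 ∈ Ω}

end Circuit

end CpH

end

set_option linter.unusedSectionVars false

open Set Topology

noncomputable section

/-! ### Derivative arrays and the index of systems affine in `x'` -/

namespace DAE

variable {X Y : Type*} [NormedAddCommGroup X] [NormedSpace ℝ X]
  [NormedAddCommGroup Y] [NormedSpace ℝ Y]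

/-! The residual has the form `h (t, x) + L x'` with a constant linear `L`, since `q'` and `φ'`
enter only as capacitor currents and inductor voltages. A rank count (`kron_eq_zero_of_card_eq`)
shows that normality of the tree kills the entries of `F` that join capacitor links to dissipator or
inductor twigs, and dissipator links to inductor twigs. Hence the range of `L` consists of all
vectors supported in the rows of capacitor twigs and inductor links
(`derivativePart_of_isAlgebraic`, `exists_derivativePart_eq`). The remaining rows are algebraic. If
there are none, `L` is invertible and the system is an ODE.

Otherwise `L` is singular, so `x'` is not determined without differentiation. That one
differentiation suffices reduces (`hasDifferentiationIndex_one`) to a linear statement: if `L p = 0`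
and `p` satisfies the linearised algebraic rows, then `p = 0`. This follows from Tellegen's theorem,
applied to currents and voltages taken from two different systems
(`dotProduct_eq_zero_of_kirchhoff`). Capacitor currents from `L p = 0`, paired with linearised
voltages, give a vanishing Hessian form in the charge velocities; inductors are dual. Once both
velocities vanish, the linearised dissipators obey Kirchhoff's laws on their own and have zero
power, which passivity forbids for a nonzero velocity (`IsMixedForm.eq_zero_of_dotProduct`). -/

lemma jetCurve_self (t : ℝ) (ξ : ℕ → X) (n : ℕ) : jetCurve t ξ n t = ξ 0 := by
  simp [jetCurve, Finset.sum_range_succ']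

lemma hasDerivAt_jetCurve_succ (t : ℝ) (ξ : ℕ → X) (n : ℕ) (s : ℝ) :
    HasDerivAt (jetCurve t ξ (n + 1)) (jetCurve t (fun m => ξ (m + 1)) n s) s := by
  have hterm : ∀ m : ℕ, HasDerivAt
      (fun s : ℝ => ((s - t) ^ (m + 1) / ((m + 1).factorial : ℝ)) • ξ (m + 1))
      (((s - t) ^ m / (m.factorial : ℝ)) • ξ (m + 1)) s := by
    intro m
    have h := ((((hasDerivAt_id s).sub_const t).fun_pow (m + 1)).div_const
      ((m + 1).factorial : ℝ)).smul_const (ξ (m + 1))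
    have hc : (s - t) ^ m / (m.factorial : ℝ)
        = ((m + 1 : ℕ) : ℝ) * (id s - t) ^ (m + 1 - 1) * 1 / ((m + 1).factorial : ℝ) := by
      have h1 : (m.factorial : ℝ) ≠ 0 := by positivity
      have h2 : ((m : ℝ) + 1) ≠ 0 := by positivity
      rw [Nat.factorial_succ]
      push_cast
      simp only [id]
      field_simp
    rw [hc]
    exact h
  have h := (HasDerivAt.fun_sum (u := Finset.range (n + 1)) fun m _ => hterm m).add_const (ξ 0)
  have hfun : jetCurve t ξ (n + 1) = fun s =>
      ∑ m ∈ Finset.range (n + 1), ((s - t) ^ (m + 1) / ((m + 1).factorial : ℝ)) • ξ (m + 1)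
        + ξ 0 := by
    funext s
    simp [jetCurve, Finset.sum_range_succ' _ (n + 1)]
  rw [hfun]
  exact h

lemma deriv_jetCurve_succ (t : ℝ) (ξ : ℕ → X) (n : ℕ) :
    deriv (jetCurve t ξ (n + 1)) = jetCurve t (fun m => ξ (m + 1)) n :=
  funext fun s => (hasDerivAt_jetCurve_succ t ξ n s).deriv

lemma arrayHolds_zero_iff (f : ℝ → X → X → Y) (I : Set ℝ) (t : ℝ) (ξ : ℕ → X) :
    ArrayHolds f I 0 t ξ ↔ f t (ξ 0) (ξ 1) = 0 := by
  simp [ArrayHolds, deriv_jetCurve_succ, jetCurve_self]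

/-- The derivative array of order one of a system that is affine in `x'`. -/
lemma arrayHolds_one_iff {f : ℝ → X → X → Y} {h : ℝ × X → Y} {L : X →L[ℝ] Y}
    (hf : ∀ t x p, f t x p = h (t, x) + L p) {I : Set ℝ} (hI : UniqueDiffOn ℝ I)
    {U : Set X} (hU : IsOpen U) (hh : DifferentiableOn ℝ h (I ×ˢ U)) {t : ℝ} (ht : t ∈ I)
    {ξ : ℕ → X} (hξ : ξ 0 ∈ U) :
    ArrayHolds f I 1 t ξ ↔
      h (t, ξ 0) + L (ξ 1) = 0 ∧ fderivWithin ℝ h (I ×ˢ U) (t, ξ 0) (1, ξ 1) + L (ξ 2) = 0 := by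
  set γ := jetCurve t ξ 2 with hγ
  have hγt : γ t = ξ 0 := jetCurve_self t ξ 2
  have hγd : HasDerivAt γ (ξ 1) t := by
    have := hasDerivAt_jetCurve_succ t ξ 1 t
    rwa [jetCurve_self] at this
  have hγ'd : HasDerivAt (deriv γ) (ξ 2) t := by
    rw [hγ, deriv_jetCurve_succ]
    have := hasDerivAt_jetCurve_succ t (fun m => ξ (m + 1)) 0 t
    rwa [jetCurve_self] at this
  have hpre : γ ⁻¹' U ∈ 𝓝 t := hγd.continuousAt (hU.mem_nhds (by rwa [hγt]))
  have hd : HasDerivWithinAt (fun s => f s (γ s) (deriv γ s))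
      (fderivWithin ℝ h (I ×ˢ U) (t, ξ 0) (1, ξ 1) + L (ξ 2)) I t := by
    simp only [hf]
    refine HasDerivWithinAt.add ?_ (L.hasFDerivAt.comp_hasDerivWithinAt t hγ'd.hasDerivWithinAt)
    -- `h` is controlled only on `I ×ˢ U`. As `U` is open, the curve stays in `U` near `t`, and the
    -- derivative within `I` may be computed within `I ∩ γ ⁻¹' U`.
    rw [← hasDerivWithinAt_inter hpre]
    have h1 : HasFDerivWithinAt h (fderivWithin ℝ h (I ×ˢ U) (t, ξ 0)) (I ×ˢ U) (t, γ t) := by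
      rw [hγt]
      exact (hh (t, ξ 0) ⟨ht, hξ⟩).hasFDerivWithinAt
    have h2 : HasDerivWithinAt (fun s => (s, γ s)) ((1 : ℝ), ξ 1) (I ∩ γ ⁻¹' U) t :=
      ((hasDerivAt_id t).prodMk hγd).hasDerivWithinAt
    have h3 : MapsTo (fun s => (s, γ s)) (I ∩ γ ⁻¹' U) (I ×ˢ U) := fun s hs => ⟨hs.1, hs.2⟩
    exact h1.comp_hasDerivWithinAt t h2 h3
  have h0 : deriv γ t = ξ 1 := hγd.deriv
  have hone : iteratedDerivWithin 1 (fun s => f s (γ s) (deriv γ s)) I t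
      = fderivWithin ℝ h (I ×ˢ U) (t, ξ 0) (1, ξ 1) + L (ξ 2) := by
    rw [iteratedDerivWithin_one]
    exact hd.derivWithin (hI t ht)
  constructor
  · intro hA
    refine ⟨?_, hone ▸ hA 1 le_rfl⟩
    have := hA 0 zero_le_one
    rw [iteratedDerivWithin_zero] at this
    change f t (γ t) (deriv γ t) = 0 at this
    rwa [hγt, h0, hf] at this
  · rintro ⟨hA, hB⟩ j hj
    obtain rfl | rfl : j = 0 ∨ j = 1 := by omega
    · rw [iteratedDerivWithin_zero]
      change f t (γ t) (deriv γ t) = 0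
      rwa [hγt, h0, hf]
    · exact hone.trans hB

/-- A bijective linear map between spaces of the same finite dimension, as a continuous linear
equivalence. -/
lemma exists_continuousLinearEquiv_of_injective [FiniteDimensional ℝ X] [FiniteDimensional ℝ Y]
    (hdim : Module.finrank ℝ X = Module.finrank ℝ Y) {M : X →L[ℝ] Y}
    (hM : Function.Injective M) : ∃ e : X ≃L[ℝ] Y, (e : X →L[ℝ] Y) = M :=
  ⟨(LinearMap.linearEquivOfInjective (M : X →ₗ[ℝ] Y) hM hdim).toContinuousLinearEquiv, by
    ext x; rfl⟩

/-- A system `h (t, x) + L x' = 0` with surjective `L` and as many equations as unknowns is an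
ordinary differential equation. -/
theorem isODE_of_surjective [FiniteDimensional ℝ X] [FiniteDimensional ℝ Y]
    (hdim : Module.finrank ℝ X = Module.finrank ℝ Y)
    {f : ℝ → X → X → Y} {h : ℝ × X → Y} {L : X →L[ℝ] Y}
    (hf : ∀ t x p, f t x p = h (t, x) + L p) {I : Set ℝ} {U : Set X}
    (hh : ContinuousOn h (I ×ˢ U)) (hL : Function.Surjective L) : IsODE f I U := by
  obtain ⟨e, rfl⟩ := exists_continuousLinearEquiv_of_injective hdim
    ((LinearMap.injective_iff_surjective_of_finrank_eq_finrank (f := (L : X →ₗ[ℝ] Y)) hdim).2 hL)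
  refine ⟨fun t x => -e.symm (h (t, x)), (e.symm.continuous.comp_continuousOn hh).neg, ?_⟩
  intro t _ x _ p
  rw [hf, eq_neg_iff_add_eq_zero, ← e.injective.eq_iff, add_comm]
  simp

/-- A system `h (t, x) + L x' = 0` has index one if `P` is a projection whose kernel is the range
of `L`, so that `P h (t, x) = 0` are the algebraic equations, and differentiating these makes the
system regular. -/
theorem hasDifferentiationIndex_one [FiniteDimensional ℝ X] [FiniteDimensional ℝ Y]
    (hdim : Module.finrank ℝ X = Module.finrank ℝ Y)
    {f : ℝ → X → X → Y} {h : ℝ × X → Y} {L : X →L[ℝ] Y}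
    (hf : ∀ t x p, f t x p = h (t, x) + L p) {I : Set ℝ} (hI : UniqueDiffOn ℝ I)
    {U : Set X} (hU : IsOpen U) (hh : ContDiffOn ℝ 1 h (I ×ˢ U))
    {P : Y →L[ℝ] Y} (hPP : ∀ y, P (P y) = P y) (hPL : ∀ p, P (L p) = 0)
    (hLP : ∀ y, P y = 0 → ∃ p, L p = y) (hP : P ≠ 0)
    (hreg : ∀ z ∈ I ×ˢ U, ∀ p, L p = 0 → P (fderivWithin ℝ h (I ×ˢ U) z (0, p)) = 0 → p = 0)
    (hcons : ∃ t ∈ I, ∃ x ∈ U, ∃ p, f t x p = 0) :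
    HasDifferentiationIndex f I U 1 := by
  have hIU : UniqueDiffOn ℝ (I ×ˢ U) := hI.prod hU.uniqueDiffOn
  have hdiff : DifferentiableOn ℝ h (I ×ˢ U) := hh.differentiableOn one_ne_zero
  set D := fun z => fderivWithin ℝ h (I ×ˢ U) z with hD
  have hDcont : ContinuousOn D (I ×ˢ U) := hh.continuousOn_fderivWithin hIU le_rfl
  -- `M z p = b z` is the equation `(1 - P) (h + L p) + P (D z (1, p)) = 0`: the algebraic rows are
  -- replaced by their time derivatives. It uses `P L = 0`.
  set M : ℝ × X → X →L[ℝ] Y :=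
    fun z => L + P.comp ((D z).comp (ContinuousLinearMap.inr ℝ ℝ X)) with hM
  set b : ℝ × X → Y := fun z => -(h z - P (h z)) - P (D z (1, 0)) with hb
  have hMcont : ContinuousOn M (I ×ˢ U) :=
    continuousOn_const.add (continuousOn_const.clm_comp (hDcont.clm_comp continuousOn_const))
  have hbcont : ContinuousOn b (I ×ˢ U) :=
    (hh.continuousOn.sub (P.continuous.comp_continuousOn hh.continuousOn)).neg.sub
      (P.continuous.comp_continuousOn (hDcont.clm_apply continuousOn_const))
  have hMapply : ∀ z p, M z p = L p + P (D z (0, p)) := fun z p => by simp [hM]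
  have hPM : ∀ z p, P (M z p) = P (D z (0, p)) := fun z p => by
    rw [hMapply, map_add, hPL, hPP, zero_add]
  have hPb : ∀ z, P (b z) = - P (D z (1, 0)) := fun z => by simp [hb, hPP]
  have hsplit : ∀ z p, D z (1, p) = D z (1, 0) + D z (0, p) := fun z p => by
    rw [← map_add]; simp
  have hequiv : ∀ z ∈ I ×ˢ U, ∃ e : X ≃L[ℝ] Y, (e : X →L[ℝ] Y) = M z := by
    intro z hz
    refine exists_continuousLinearEquiv_of_injective hdim ?_
    -- Applying `P` separates the two summands of `M z p`, so both vanish.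
    refine (injective_iff_map_eq_zero (M z)).2 fun p hp => ?_
    have h1 : P (D z (0, p)) = 0 := by rw [← hPM, hp, map_zero]
    have h2 : L p = 0 := by rw [hMapply, h1, add_zero] at hp; exact hp
    exact hreg z hz p h2 h1
  refine ⟨?_, ?_, ?_, ?_⟩
  · have : (fun z : ℝ × X × X => f z.1 z.2.1 z.2.2) = fun z => h (z.1, z.2.1) + L z.2.2 :=
      funext fun z => hf _ _ _
    rw [this]
    refine ContDiffOn.add (hh.comp (t := I ×ˢ U) ?_ ?_) ?_
    · fun_prop
    · rintro ⟨t, x, p⟩ ⟨ht, hx, -⟩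
      exact ⟨ht, hx⟩
    · fun_prop
  · obtain ⟨t, ht, x, hx, p, hp⟩ := hcons
    have hz : (t, x) ∈ I ×ˢ U := ⟨ht, hx⟩
    obtain ⟨e, he⟩ := hequiv _ hz
    have hPh : P (h (t, x)) = 0 := by
      have := congrArg P (hf t x p)
      rw [hp, map_add, hPL, map_zero, add_zero] at this
      exact this.symm
    -- The given `p` may violate the differentiated algebraic equations, so `x'` is chosen anew as
    -- the solution `q` of the regular system. Then `D (t, x) (1, q)` lies in the kernel of `P`,
    -- that is, in the range of `L`, and `x''` can absorb it.
    obtain ⟨q, hq⟩ : ∃ q, M (t, x) q = b (t, x) := by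
      rw [← he]
      exact e.surjective _
    have h1 : P (D (t, x) (0, q)) = - P (D (t, x) (1, 0)) := by rw [← hPM, hq, hPb]
    obtain ⟨r, hr⟩ : ∃ r, L r = -D (t, x) (1, q) := by
      refine hLP _ ?_
      rw [map_neg, hsplit, map_add, h1, add_neg_cancel, neg_zero]
    refine ⟨t, ht, fun m => if m = 0 then x else if m = 1 then q else r, by simpa using hx, ?_⟩
    rw [arrayHolds_one_iff hf hI hU hdiff ht (by simpa using hx)]
    have h2 : L q = -h (t, x) := by
      rw [hMapply, h1, hb] at hq
      simp only [hPh, sub_zero] at hq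
      rwa [sub_eq_add_neg, add_left_inj] at hq
    simp only [hD] at hr
    simp [h2, hr]
  · refine ⟨fun t x => (M (t, x)).inverse (b (t, x)), ?_, ?_⟩
    · refine ContinuousOn.clm_apply (fun z hz => ?_) hbcont
      obtain ⟨e, he⟩ := hequiv z hz
      -- Inversion is continuous at invertible maps, and `M z` is invertible at every point of `I ×ˢ
      -- U`.
      have h1 : ContinuousAt ContinuousLinearMap.inverse (M z) := by
        rw [← he]
        exact (contDiffAt_map_inverse (n := 0) e).continuousAt
      exact h1.comp_continuousWithinAt (hMcont z hz)
    · intro t ht ξ hξ hA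
      obtain ⟨h1, h2⟩ := (arrayHolds_one_iff hf hI hU hdiff ht hξ).1 hA
      obtain ⟨e, he⟩ := hequiv (t, ξ 0) ⟨ht, hξ⟩
      have h3 : P (h (t, ξ 0)) = 0 := by
        have := congrArg P h1
        rwa [map_add, hPL, map_zero, add_zero] at this
      have h4 : P (D (t, ξ 0) (0, ξ 1)) = -P (D (t, ξ 0) (1, 0)) := by
        have := congrArg P h2
        rw [map_add, hPL, map_zero, add_zero] at this
        change P (D (t, ξ 0) (1, ξ 1)) = 0 at this
        rw [hsplit, map_add] at this
        exact eq_neg_of_add_eq_zero_right this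
      have h5 : e (ξ 1) = b (t, ξ 0) := by
        change (e : X →L[ℝ] Y) (ξ 1) = _
        rw [he, hMapply, h4, hb]
        simp only [h3, sub_zero]
        rw [sub_eq_add_neg, add_left_inj]
        exact eq_neg_of_add_eq_zero_right h1
      change ξ 1 = (M (t, ξ 0)).inverse (b (t, ξ 0))
      rw [← he, ContinuousLinearMap.inverse_equiv, ← h5]
      simp
  · intro k hk t ht ξ hξ hA
    obtain rfl : k = 0 := by omega
    -- The range of `L` lies in the kernel of `P ≠ 0`. By equality of dimensions `L` then has a
    -- kernel vector `v`, and adding it to `x'` preserves the undifferentiated equations.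
    have hns : ¬ Function.Surjective L := fun hs => hP <| by
      ext y
      obtain ⟨p, rfl⟩ := hs y
      simp [hPL]
    have hni : ¬ Function.Injective L := fun hi => hns
      ((LinearMap.injective_iff_surjective_of_finrank_eq_finrank
        (f := (L : X →ₗ[ℝ] Y)) hdim).1 hi)
    obtain ⟨v, hv, hv0⟩ : ∃ v, L v = 0 ∧ v ≠ 0 := by
      by_contra! hcon
      exact hni ((injective_iff_map_eq_zero L).2 hcon)
    refine ⟨fun m => if m = 0 then ξ 0 else ξ 1 + v, by simp, ?_, by simpa using hv0⟩
    have h1 := (arrayHolds_zero_iff f I t ξ).1 fun j hj => ?_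
    · rw [arrayHolds_zero_iff]
      rw [hf] at h1 ⊢
      simpa [hv] using h1
    · obtain rfl : j = 0 := by omega
      have h1 := ((arrayHolds_one_iff hf hI hU hdiff ht hξ).1 hA).1
      simp [deriv_jetCurve_succ, jetCurve_self, hf, h1]

end DAE

namespace CpH

namespace Circuit

/-! ### Cycles from walks without backtracking -/

section Walks

variable {V E : Type*} (c : Circuit V E)

/-- An infinite walk that never uses the same edge twice in a row closes up to a cycle, if there
are finitely many vertices. -/
lemma hasCycle_of_walk [Finite V] {S : Set E} {v : ℕ → V} {e : ℕ → E}
    (hS : ∀ n, e n ∈ S) (hj : ∀ n, c.Joins (e n) (v n) (v (n + 1)))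
    (he : ∀ n, e (n + 1) ≠ e n) : c.HasCycle S := by
  classical
  -- The cycle is a stretch between two visits to one vertex with the smallest possible gap; the gap
  -- is written `d + 1` to keep it positive.
  have hex : ∃ d, ∃ a, v a = v (a + (d + 1)) := by
    obtain ⟨a, b, hab, hv⟩ := Finite.exists_ne_map_eq_of_infinite v
    rcases lt_or_gt_of_ne hab with h | h
    · exact ⟨b - a - 1, a, by rw [hv]; congr 1; omega⟩
    · exact ⟨a - b - 1, b, by rw [← hv]; congr 1; omega⟩
  obtain ⟨a, ha⟩ := Nat.find_spec hex
  set l := Nat.find hex with hl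
  have hmin : ∀ i j, i < j → j ≤ l + i → v (a + i) ≠ v (a + j) := by
    intro i j hij hjl hv
    refine Nat.find_min hex (m := j - i - 1) (by omega) ⟨a + i, ?_⟩
    rw [hv]
    congr 1
    omega
  have hne : ∀ i j, i < j → j ≤ l → e (a + i) ≠ e (a + j) := by
    intro i j hij hjl heq
    have h1 := hj (a + i)
    have h2 := hj (a + j)
    rw [heq] at h1
    have hvij := hmin i j hij (by omega)
    -- Equal edges have the same pair of ends, and the starting points differ, so the ends match
    -- crosswise. By minimality the two steps are then consecutive, which the no-backtracking
    -- hypothesis excludes.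
    have h3 : v (a + (i + 1)) = v (a + j) := by
      rcases h1 with ⟨p, q⟩ | ⟨p, q⟩ <;> rcases h2 with ⟨p', q'⟩ | ⟨p', q'⟩
      · exact absurd (p.symm.trans p') hvij
      · exact q.symm.trans q'
      · exact p.symm.trans p'
      · exact absurd (q.symm.trans q') hvij
    rcases Nat.lt_or_ge (i + 1) j with h4 | h4
    · exact hmin (i + 1) j h4 (by omega) h3
    · obtain rfl : j = i + 1 := by omega
      exact he (a + i) heq.symm
  refine ⟨l, fun i => v (a + i), fun i => e (a + i), ?_, ?_, fun i => ⟨hS _, ?_⟩⟩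
  · intro i j hij
    by_contra hne'
    rcases lt_or_gt_of_ne (Fin.val_ne_of_ne hne') with h | h
    · exact hmin i j h (by omega) hij
    · exact hmin j i h (by omega) hij.symm
  · intro i j hij
    by_contra hne'
    rcases lt_or_gt_of_ne (Fin.val_ne_of_ne hne') with h | h
    · exact hne i j h (by omega) hij
    · exact hne j i h (by omega) hij.symm
  · have hv : v (a + ((i + 1 : Fin (l + 1)) : ℕ)) = v (a + i + 1) := by
      rw [Fin.val_add_one]
      split_ifs with h
      · rw [add_zero, ha, h, Fin.val_last]
        rfl
      · rfl
    change c.Joins (e (a + i)) (v (a + i)) (v (a + ((i + 1 : Fin (l + 1)) : ℕ)))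
    rw [hv]
    exact hj (a + i)

end Walks

/-! ### Incidence columns, the Kron matrix and normal trees -/

section Columns

variable {V E : Type*} [DecidableEq V] (c : Circuit V E)

/-- The column of the incidence matrix that belongs to an edge. -/
def column (e : E) : V → ℝ := fun v => c.incidence v e

lemma incidence_ne_zero_iff (v : V) (e : E) :
    c.incidence v e ≠ 0 ↔ v = c.src e ∨ v = c.tgt e := by
  simp only [incidence, Matrix.of_apply]
  split_ifs with h1 h2 <;> simp [*]

lemma column_eq (e : E) : c.column e = Pi.single (c.src e) 1 - Pi.single (c.tgt e) 1 := by
  funext v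
  have := c.src_ne_tgt e
  simp only [column, incidence, Matrix.of_apply, Pi.sub_apply, Pi.single_apply]
  split_ifs with h1 h2 <;> simp_all

end Columns

variable {V E : Type*} [Fintype V] [DecidableEq V] [Fintype E] [DecidableEq E] (c : Circuit V E)

/-- The edges of a nontrivial linear relation between the columns of the incidence matrix contain
a cycle. -/
lemma hasCycle_of_relation {a : E → ℝ} (ha : ∑ e, a e • c.column e = 0) (ha0 : a ≠ 0) :
    c.HasCycle {e | a e ≠ 0} := by
  -- The support of the relation has no leaf: at each vertex the nonzero terms cancel, so there are
  -- at least two of them.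
  have hother : ∀ (e : E) (v : V), a e ≠ 0 → c.incidence v e ≠ 0 →
      ∃ e', e' ≠ e ∧ a e' ≠ 0 ∧ c.incidence v e' ≠ 0 := by
    intro e v hae hve
    by_contra! hcon
    have h := congrFun ha v
    simp only [Finset.sum_apply, Pi.smul_apply, smul_eq_mul, Pi.zero_apply, column] at h
    rw [Finset.sum_eq_single e] at h
    · exact (mul_ne_zero hae hve) h
    · intro e' _ hne
      by_cases h0 : a e' = 0
      · simp [h0]
      · simp [hcon e' hne h0]
    · simp
  -- A state of the walk is the edge just used together with the end reached. Hence the edge from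
  -- vertex `n` to vertex `n + 1` is stored in state `n + 1`.
  let S := {x : E × V // a x.1 ≠ 0 ∧ c.incidence x.2 x.1 ≠ 0}
  have hnext : ∀ x : S, ∃ y : S, y.1.1 ≠ x.1.1 ∧ c.Joins y.1.1 x.1.2 y.1.2 := by
    rintro ⟨⟨e, v⟩, h1, h2⟩
    obtain ⟨e', hne, h3, h4⟩ := hother e v h1 h2
    rcases (c.incidence_ne_zero_iff v e').1 h4 with h | h
    · exact ⟨⟨(e', c.tgt e'), h3, (c.incidence_ne_zero_iff _ _).2 (Or.inr rfl)⟩, hne,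
        Or.inl ⟨h.symm, rfl⟩⟩
    · exact ⟨⟨(e', c.src e'), h3, (c.incidence_ne_zero_iff _ _).2 (Or.inl rfl)⟩, hne,
        Or.inr ⟨rfl, h.symm⟩⟩
  choose nxt hnxt using hnext
  obtain ⟨e₀, he₀⟩ := Function.ne_iff.1 ha0
  let x₀ : S := ⟨(e₀, c.src e₀), he₀, (c.incidence_ne_zero_iff _ _).2 (Or.inl rfl)⟩
  let x : ℕ → S := fun n => nxt^[n] x₀
  have hx : ∀ n, x (n + 1) = nxt (x n) := fun n => Function.iterate_succ_apply' nxt n x₀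
  refine c.hasCycle_of_walk (v := fun n => (x n).1.2) (e := fun n => (x (n + 1)).1.1)
    (fun n => (x (n + 1)).2.1) (fun n => ?_) (fun n => ?_)
  · rw [hx]
    exact (hnxt (x n)).2
  · rw [hx (n + 1)]
    exact (hnxt (x (n + 1))).1

lemma HasCycle.mono {V E : Type*} {c : Circuit V E} {S S' : Set E} (h : c.HasCycle S)
    (hS : S ⊆ S') : c.HasCycle S' := by
  obtain ⟨l, v, e, hv, he, h⟩ := h
  exact ⟨l, v, e, hv, he, fun i => ⟨hS (h i).1, (h i).2⟩⟩

variable {c} {T : Finset E}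

/-- A nontrivial relation between twig columns, extended by zero, would put a cycle into the tree.
-/
lemma linearIndependent_column (hT : ¬ c.HasCycle (T : Set E)) :
    LinearIndependent ℝ fun e : {e // e ∈ T} => c.column e := by
  rw [Fintype.linearIndependent_iff]
  intro g hg
  by_contra! hcon
  obtain ⟨e₀, he₀⟩ := hcon
  set a : E → ℝ := fun e => if h : e ∈ T then g ⟨e, h⟩ else 0 with ha
  have haT : ∀ e : {e // e ∈ T}, a e = g e := fun e => by simp [ha]
  have hsum : ∑ e, a e • c.column e = 0 := by
    rw [← hg, ← Finset.sum_subset T.subset_univ, ← Finset.sum_coe_sort T]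
    · exact Finset.sum_congr rfl fun e _ => by rw [haT]
    · intro e _ he
      simp [ha, he]
  refine hT ((c.hasCycle_of_relation hsum ?_).mono ?_)
  · exact Function.ne_iff.2 ⟨e₀, by rw [haT]; exact he₀⟩
  · intro e he
    by_contra hne
    exact he (by simp only [ha]; rw [dif_neg (by simpa using hne)])

/-- A column is a difference of two vertex unit vectors, which telescopes along a path in `T`
between the two ends. -/
lemma column_mem_span (hT : c.IsSpanning (T : Set E)) (r : E) :
    c.column r ∈ Submodule.span ℝ (range fun e : {e // e ∈ T} => c.column e) := by
  have hpath : ∀ u w : V, (Pi.single u 1 - Pi.single w 1 : V → ℝ) ∈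
      Submodule.span ℝ (range fun e : {e // e ∈ T} => c.column e) := by
    intro u w
    induction hT.2 u w with
    | refl => simp
    | @tail b d _ h ih =>
      obtain ⟨e, he, hj⟩ := h
      have hcol : c.column e ∈ Submodule.span ℝ (range fun e : {e // e ∈ T} => c.column e) :=
        Submodule.subset_span ⟨⟨e, he⟩, rfl⟩
      rw [column_eq] at hcol
      rw [← sub_add_sub_cancel _ (Pi.single b 1)]
      refine add_mem ih ?_
      rcases hj with ⟨rfl, rfl⟩ | ⟨rfl, rfl⟩
      · exact hcol
      · rw [← neg_sub]
        exact neg_mem hcol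
  rw [column_eq]
  exact hpath _ _

/-- The defining property of `kron` becomes available here: a matrix of the required kind exists, so
`Classical.epsilon` selects one. -/
lemma column_link_eq (hT : c.IsSpanning (T : Set E)) (r : {e // e ∉ T}) :
    c.column r = ∑ s : {e // e ∈ T}, (-c.kron T r s) • c.column s := by
  have hex : ∃ F : Matrix {e : E // e ∉ T} {e : E // e ∈ T} ℝ,
      ∀ (r : {e : E // e ∉ T}) (v : V),
        c.incidence v r = -∑ s : {e : E // e ∈ T}, F r s * c.incidence v s := by
    choose a ha using fun r : {e // e ∉ T} =>
      (Submodule.mem_span_range_iff_exists_fun ℝ).1 (column_mem_span hT r)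
    refine ⟨fun r s => -a r s, fun r v => ?_⟩
    have := congrFun (ha r) v
    simp only [Finset.sum_apply, Pi.smul_apply, smul_eq_mul, column] at this
    rw [← this]
    simp
  funext v
  have := Classical.epsilon_spec hex r v
  simp only [column, Finset.sum_apply, Pi.smul_apply, smul_eq_mul]
  rw [this]
  simp [kron]

lemma rankOf_eq_finrank (K : Finset Kind) :
    c.rankOf K = Module.finrank ℝ (Submodule.span ℝ (c.column '' {e | c.kind e ∈ K})) := by
  have hrange : range (c.incidence.submatrix id fun e : {e : E // c.kind e ∈ K} => e.1).col
      = c.column '' {e | c.kind e ∈ K} := by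
    rw [image_eq_range]
    rfl
  rw [rankOf, Matrix.rank_eq_finrank_span_cols, hrange]

/-- The number of twigs with kinds in `K` is the dimension of the span of their columns. -/
lemma finrank_span_twigs (hT : ¬ c.HasCycle (T : Set E)) (K : Finset Kind) :
    Module.finrank ℝ (Submodule.span ℝ (c.column '' {e | e ∈ T ∧ c.kind e ∈ K}))
      = (T.filter fun e => c.kind e ∈ K).card := by
  have hli : LinearIndependent ℝ
      fun e : {e // e ∈ T.filter fun e => c.kind e ∈ K} => c.column e :=
    linearIndependent_column fun h => hT <| h.mono <| by
      intro e he
      exact (Finset.mem_filter.1 he).1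
  have h := finrank_span_eq_card hli
  rw [Fintype.card_coe] at h
  have himage : c.column '' {e | e ∈ T ∧ c.kind e ∈ K}
      = range fun e : {e // e ∈ T.filter fun e => c.kind e ∈ K} => c.column e := by
    ext f
    simp
  rw [himage, h]

/-- If the twigs with kinds in `K` are as many as the rank of the edges with kinds in `K`, then
the fundamental cycle of a link with kind in `K` has only twigs with kinds in `K`. -/
lemma kron_eq_zero_of_card_eq (hT : c.IsTree (T : Set E)) {K : Finset Kind}
    (hK : (T.filter fun e => c.kind e ∈ K).card = c.rankOf K) (r : {e // e ∉ T})
    (s : {e // e ∈ T}) (hr : c.kind r ∈ K) (hs : c.kind s ∉ K) : c.kron T r s = 0 := by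
  -- By dimension, the twigs of `K` span all columns of `K`. Independence of the twig columns then
  -- identifies this expansion of the link column with its row of the Kron matrix.
  have hspan : Submodule.span ℝ (c.column '' {e | e ∈ T ∧ c.kind e ∈ K})
      = Submodule.span ℝ (c.column '' {e | c.kind e ∈ K}) := by
    refine Submodule.eq_of_le_of_finrank_eq (Submodule.span_mono (image_mono fun e he => he.2)) ?_
    rw [finrank_span_twigs hT.2, hK, rankOf_eq_finrank]
  have hmem : c.column r ∈ Submodule.span ℝ (c.column '' {e | e ∈ T ∧ c.kind e ∈ K}) := by
    rw [hspan]
    exact Submodule.subset_span ⟨r, hr, rfl⟩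
  have himage : c.column '' {e | e ∈ T ∧ c.kind e ∈ K}
      = (fun e : {e // e ∈ T} => c.column e) '' {e | c.kind e ∈ K} := by
    ext f
    exact ⟨fun ⟨e, ⟨h1, h2⟩, h⟩ => ⟨⟨e, h1⟩, h2, h⟩, fun ⟨⟨e, h1⟩, h2, h⟩ => ⟨e, ⟨h1, h2⟩, h⟩⟩
  rw [himage, Finsupp.mem_span_image_iff_linearCombination] at hmem
  obtain ⟨l, hl, hlr⟩ := hmem
  have hli := linearIndependent_column hT.2
  have hl' : l = Finsupp.equivFunOnFinite.symm fun s => -c.kron T r s := by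
    apply hli
    rw [hlr, column_link_eq hT.1 r, Finsupp.linearCombination_apply,
      Finsupp.sum_fintype _ _ (by simp)]
    rfl
  have hs0 : l s = 0 := by
    by_contra hne
    exact hs ((Finsupp.mem_supported ℝ l).1 hl (Finsupp.mem_support_iff.2 hne))
  rw [hl'] at hs0
  simpa using hs0

lemma card_twigs_insert {E : Type*} [DecidableEq E] {V : Type*} {c : Circuit V E} {T : Finset E}
    {k : Kind} {K : Finset Kind} (hk : k ∉ K) :
    (T.filter fun e => c.kind e ∈ insert k K).card
      = c.nTwig T k + (T.filter fun e => c.kind e ∈ K).card := by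
  rw [nTwig, ← Finset.card_union_of_disjoint, ← Finset.filter_or]
  · simp
  · refine Finset.disjoint_filter.2 fun e _ h1 h2 => hk ?_
    rwa [h1] at h2

namespace IsNormalTree

/-- All voltage sources are twigs, so their columns are independent. From this base case the
differences of ranks in `IsNormalTree` telescope to the next two counts. -/
lemma card_vsrc (hT : c.IsNormalTree T) :
    (T.filter fun e => c.kind e ∈ ({Kind.vsrc} : Finset Kind)).card
    = c.rankOf {Kind.vsrc} := by
  rw [← finrank_span_twigs hT.isTree.2, rankOf_eq_finrank]
  have hset : {e | e ∈ T ∧ c.kind e ∈ ({Kind.vsrc} : Finset Kind)}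
      = {e | c.kind e ∈ ({Kind.vsrc} : Finset Kind)} := by
    ext e
    simpa using hT.vsrc e
  rw [hset]

lemma card_vsrc_cap (hT : c.IsNormalTree T) :
    (T.filter fun e => c.kind e ∈ ({Kind.vsrc, Kind.cap} : Finset Kind)).card
    = c.rankOf {Kind.vsrc, Kind.cap} := by
  rw [← hT.cap, ← hT.card_vsrc, ← card_twigs_insert (by decide), Finset.pair_comm]

lemma card_vsrc_cap_diss (hT : c.IsNormalTree T) :
    (T.filter fun e => c.kind e ∈ ({Kind.vsrc, Kind.cap, Kind.diss} : Finset Kind)).card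
    = c.rankOf {Kind.vsrc, Kind.cap, Kind.diss} := by
  rw [← hT.diss, ← hT.card_vsrc_cap, ← card_twigs_insert (by decide),
    show ({Kind.vsrc, Kind.cap, Kind.diss} : Finset Kind) = {Kind.diss, Kind.vsrc, Kind.cap}
      by decide]

lemma kron_cap_eq_zero (hT : c.IsNormalTree T) (r : {e // e ∉ T}) (s : {e // e ∈ T})
    (hr : c.kind r = Kind.cap)
    (hs : c.kind s = Kind.diss ∨ c.kind s = Kind.ind) : c.kron T r s = 0 :=
  kron_eq_zero_of_card_eq hT.isTree hT.card_vsrc_cap r s (by simp [hr])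
    (by rcases hs with hs | hs <;> simp [hs])

lemma kron_diss_eq_zero (hT : c.IsNormalTree T) (r : {e // e ∉ T}) (s : {e // e ∈ T})
    (hr : c.kind r = Kind.diss)
    (hs : c.kind s = Kind.ind) : c.kron T r s = 0 :=
  kron_eq_zero_of_card_eq hT.isTree hT.card_vsrc_cap_diss r s (by simp [hr]) (by simp [hs])

end IsNormalTree

end Circuit

/-! ### Jacobians and Hessians as derivatives -/

section Calculus

variable {ι : Type*} [Fintype ι] [DecidableEq ι]

lemma jacobian_mulVec {g : (ι → ℝ) → (ι → ℝ)} {x : ι → ℝ} (hg : DifferentiableAt ℝ g x)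
    (p : ι → ℝ) : (jacobian g x).mulVec p = fderiv ℝ g x p := by
  funext i
  have hgi : fderiv ℝ g x p i = fderiv ℝ (fun y => g y i) x p := by
    rw [fderiv_apply hg]
    rfl
  rw [hgi]
  conv_rhs => rw [pi_eq_sum_univ' p, map_sum]
  simp [Matrix.mulVec, dotProduct, jacobian, pderiv, mul_comm]

lemma contDiff_pderiv {H : (ι → ℝ) → ℝ} (hH : ContDiff ℝ 2 H) : ContDiff ℝ 1 (pderiv H) :=
  contDiff_pi.2 fun _ => (hH.fderiv_right (m := 1) (by norm_num)).clm_apply contDiff_const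

lemma fderiv_pderiv {H : (ι → ℝ) → ℝ} (hH : ContDiff ℝ 2 H) (x p : ι → ℝ) :
    fderiv ℝ (pderiv H) x p = (hessian H x).mulVec p :=
  (jacobian_mulVec ((contDiff_pderiv hH).differentiable one_ne_zero x) p).symm

lemma IsPD.eq_zero {M : Matrix ι ι ℝ} (hM : IsPD M) {y : ι → ℝ} (hy : y ⬝ᵥ M.mulVec y = 0) :
    y = 0 := by
  by_contra hne
  exact (hM y hne).ne' hy

end Calculus

namespace Circuit

/-! ### Dissipator coordinates, extension by zero and Kirchhoff's laws -/

section Mix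

variable {δ : Type*} [Fintype δ] [DecidableEq δ] (G : Finset δ)

lemma mix_mix (a b : δ → ℝ) : mix G (mix G a b) (mix G b a) = a := by
  funext j
  by_cases hj : j ∈ G <;> simp [mix, hj]

/-- `mix` as a continuous linear map. -/
def mixL : ((δ → ℝ) × (δ → ℝ)) →L[ℝ] (δ → ℝ) :=
  LinearMap.toContinuousLinearMap
    { toFun := fun z => mix G z.1 z.2
      map_add' := fun z w => by
        funext j
        by_cases hj : j ∈ G <;> simp [mix, hj]
      map_smul' := fun r z => by
        funext j
        by_cases hj : j ∈ G <;> simp [mix, hj] }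

end Mix

variable {V E : Type*} [Fintype E] [DecidableEq E] (c : Circuit V E)

/-- Extension by zero of a vector indexed by the edges of kind `k`. -/
def extend (k : Kind) : (c.Edge k → ℝ) →L[ℝ] (E → ℝ) :=
  LinearMap.toContinuousLinearMap
    { toFun := fun a e => if h : c.kind e = k then a ⟨e, h⟩ else 0
      map_add' := fun a b => by
        funext e
        by_cases h : c.kind e = k <;> simp [h]
      map_smul' := fun r a => by
        funext e
        by_cases h : c.kind e = k <;> simp [h] }

variable {c}

lemma extend_of_eq {k : Kind} (a : c.Edge k → ℝ) {e : E} (h : c.kind e = k) :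
    c.extend k a e = a ⟨e, h⟩ := dif_pos h

lemma extend_of_ne {k : Kind} (a : c.Edge k → ℝ) {e : E} (h : c.kind e ≠ k) :
    c.extend k a e = 0 := dif_neg h

lemma kind_eq_of_extend_ne_zero {k : Kind} {a : c.Edge k → ℝ} {e : E}
    (h : c.extend k a e ≠ 0) : c.kind e = k := by
  by_contra hne
  exact h (extend_of_ne a hne)

lemma sum_extend_mul (k : Kind) (a : c.Edge k → ℝ) (w : E → ℝ) :
    ∑ e, c.extend k a e * w e = a ⬝ᵥ fun e => w e := by
  rw [← Fintype.sum_subtype_add_sum_subtype (fun e => c.kind e = k)]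
  have h1 : ∑ e : {e // ¬ c.kind e = k}, c.extend k a e * w e = 0 :=
    Finset.sum_eq_zero fun e _ => by rw [extend_of_ne a e.2, zero_mul]
  rw [h1, add_zero]
  exact Finset.sum_congr rfl fun e _ => by rw [extend_of_eq a e.2]

variable [Fintype V] [DecidableEq V] {T : Finset E}

lemma kirchhoff_twig {i v : E → ℝ} {e : E} (he : e ∈ T) :
    c.kirchhoff T i v e = i e - ∑ r : {e : E // e ∉ T}, c.kron T r ⟨e, he⟩ * i r := dif_pos he

lemma kirchhoff_link {i v : E → ℝ} {e : E} (he : e ∉ T) :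
    c.kirchhoff T i v e = v e + ∑ s : {e : E // e ∈ T}, c.kron T ⟨e, he⟩ s * v s := dif_neg he

/-- The residual of Kirchhoff's laws in the rows of the edges that are not sources, as a
continuous linear map of currents and voltages. -/
def kirchhoffL (c : Circuit V E) (T : Finset E) :
    ((E → ℝ) × (E → ℝ)) →L[ℝ] (c.NonSource → ℝ) :=
  LinearMap.toContinuousLinearMap
    { toFun := fun z e => c.kirchhoff T z.1 z.2 e
      map_add' := fun z w => by
        funext e
        by_cases h : e.1 ∈ T
        · simp only [kirchhoff_twig h, Pi.add_apply, Prod.fst_add, mul_add, Finset.sum_add_distrib]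
          ring
        · simp only [kirchhoff_link h, Pi.add_apply, Prod.snd_add, mul_add, Finset.sum_add_distrib]
          ring
      map_smul' := fun a z => by
        funext e
        by_cases h : e.1 ∈ T
        · simp only [kirchhoff_twig h, Pi.smul_apply, Prod.smul_fst, smul_eq_mul, RingHom.id_apply,
            mul_sub, Finset.mul_sum, mul_left_comm a]
        · simp only [kirchhoff_link h, Pi.smul_apply, Prod.smul_snd, smul_eq_mul, RingHom.id_apply,
            mul_add, Finset.mul_sum, mul_left_comm a] }

/-- Tellegen's theorem, with the residuals of Kirchhoff's laws. -/
lemma sum_current_mul_voltage (i v : E → ℝ) :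
    ∑ e, i e * v e = ∑ e, c.kirchhoff T i v e * if e ∈ T then v e else i e := by
  have hsplit : ∀ w : E → ℝ,
      ∑ e, w e = ∑ s : {e // e ∈ T}, w s + ∑ r : {e // e ∉ T}, w r := by
    intro w
    rw [← Fintype.sum_subtype_add_sum_subtype (fun e => e ∈ T) w]
    congr 1
    exact Finset.sum_congr (by ext; simp) fun _ _ => rfl
  rw [hsplit, hsplit fun e => c.kirchhoff T i v e * _]
  have h1 : ∑ s : {e // e ∈ T}, (c.kirchhoff T i v s * if s.1 ∈ T then v s else i s)
      = ∑ s : {e // e ∈ T}, i s * v s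
        - ∑ s : {e // e ∈ T}, ∑ r : {e // e ∉ T}, c.kron T r s * i r * v s := by
    rw [← Finset.sum_sub_distrib]
    refine Finset.sum_congr rfl fun s _ => ?_
    rw [kirchhoff_twig s.2, if_pos s.2, sub_mul, Finset.sum_mul]
  have h2 : ∑ r : {e // e ∉ T}, (c.kirchhoff T i v r * if r.1 ∈ T then v r else i r)
      = ∑ r : {e // e ∉ T}, i r * v r
        + ∑ r : {e // e ∉ T}, ∑ s : {e // e ∈ T}, c.kron T r s * i r * v s := by
    rw [← Finset.sum_add_distrib]
    refine Finset.sum_congr rfl fun r _ => ?_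
    rw [kirchhoff_link r.2, if_neg r.2, add_mul, Finset.sum_mul, mul_comm (v r)]
    congr 1
    exact Finset.sum_congr rfl fun s _ => by ring
  -- The two double sums over the entries of `F` cancel, because the same matrix enters the current
  -- law with a minus and the voltage law with a plus.
  rw [h1, h2, Finset.sum_comm (s := (Finset.univ : Finset {e // e ∉ T}))]
  ring

/-- In Tellegen's identity a twig residual is weighted by the twig voltage and a link residual by
the link current, so Kirchhoff's laws are needed only where these weights are nonzero. -/
lemma sum_current_mul_voltage_eq_zero {i v : E → ℝ}
    (htwig : ∀ e ∈ T, v e ≠ 0 → c.kirchhoff T i v e = 0)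
    (hlink : ∀ e ∉ T, i e ≠ 0 → c.kirchhoff T i v e = 0) : ∑ e, i e * v e = 0 := by
  rw [sum_current_mul_voltage (c := c) (T := T)]
  refine Finset.sum_eq_zero fun e _ => ?_
  split_ifs with he
  · by_cases h : v e = 0
    · rw [h, mul_zero]
    · rw [htwig e he h, zero_mul]
  · by_cases h : i e = 0
    · rw [h, mul_zero]
    · rw [hlink e he h, zero_mul]

/-! #### Splitting of the state equation -/

/-- The edges whose rows in the state equation do not contain derivatives: all but the capacitors
in the tree and the inductors in the cotree. -/
def IsAlgebraic (c : Circuit V E) (T : Finset E) (e : E) : Prop :=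
  ¬ (c.kind e = Kind.cap ∧ e ∈ T ∨ c.kind e = Kind.ind ∧ e ∉ T)

instance (c : Circuit V E) (T : Finset E) : DecidablePred (c.IsAlgebraic T) := fun e =>
  inferInstanceAs (Decidable (¬ (c.kind e = Kind.cap ∧ e ∈ T ∨ c.kind e = Kind.ind ∧ e ∉ T)))

/-- Projection onto the algebraic rows. -/
def algebraicPart (c : Circuit V E) (T : Finset E) :
    (c.NonSource → ℝ) →L[ℝ] (c.NonSource → ℝ) :=
  LinearMap.toContinuousLinearMap
    { toFun := fun y e => if c.IsAlgebraic T e then y e else 0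
      map_add' := fun y z => by
        funext e
        by_cases h : c.IsAlgebraic T e <;> simp [h]
      map_smul' := fun r y => by
        funext e
        by_cases h : c.IsAlgebraic T e <;> simp [h] }

lemma algebraicPart_apply (y : c.NonSource → ℝ) (e : c.NonSource) :
    c.algebraicPart T y e = if c.IsAlgebraic T e then y e else 0 := rfl

lemma algebraicPart_algebraicPart (y : c.NonSource → ℝ) :
    c.algebraicPart T (c.algebraicPart T y) = c.algebraicPart T y := by
  funext e
  simp only [algebraicPart_apply]
  split_ifs <;> rfl

/-- Among the edges that are not sources, the algebraic ones are the capacitor links, the inductor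
twigs and all dissipators. -/
lemma forall_not_isAlgebraic_iff :
    (c.nLink T Kind.cap = 0 ∧ c.nTwig T Kind.ind = 0 ∧ c.nTwig T Kind.diss = 0 ∧
      c.nLink T Kind.diss = 0) ↔ ∀ e : c.NonSource, ¬ c.IsAlgebraic T e := by
  simp only [nLink, nTwig, Finset.card_eq_zero, Finset.filter_eq_empty_iff, Finset.mem_compl,
    IsAlgebraic, not_not]
  constructor
  · rintro ⟨h1, h2, h3, h4⟩ ⟨e, he⟩
    cases hk : c.kind e <;> by_cases heT : e ∈ T <;> simp_all
  · intro h
    refine ⟨?_, ?_, ?_, ?_⟩ <;>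
    · intro e heT hk
      simpa [hk, heT] using h ⟨e, by simp [hk]⟩

variable (c T) in
/-- The part of the state equation that contains the derivatives. -/
def derivativePart : c.State →L[ℝ] (c.NonSource → ℝ) :=
  (c.kirchhoffL T).comp
    (((c.extend Kind.cap).comp (ContinuousLinearMap.fst ℝ _ _)).prod
      ((c.extend Kind.ind).comp
        ((ContinuousLinearMap.fst ℝ _ _).comp (ContinuousLinearMap.snd ℝ _ _))))

lemma derivativePart_apply (p : c.State) (e : c.NonSource) :
    c.derivativePart T p e
      = c.kirchhoff T (c.extend Kind.cap p.1) (c.extend Kind.ind p.2.1) e := rfl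

/-- Derivatives could reach these rows only through currents of capacitor links or voltages of
inductor twigs, and normality makes the relevant entries of `F` zero. -/
lemma derivativePart_of_isAlgebraic (hT : c.IsNormalTree T) (p : c.State) {e : c.NonSource}
    (he : c.IsAlgebraic T e) : c.derivativePart T p e = 0 := by
  obtain ⟨e, hV, hI⟩ := e
  rw [derivativePart_apply]
  change ¬ (c.kind e = Kind.cap ∧ e ∈ T ∨ c.kind e = Kind.ind ∧ e ∉ T) at he
  by_cases heT : e ∈ T
  · have hk : c.kind e = Kind.diss ∨ c.kind e = Kind.ind := by
      cases h : c.kind e <;> simp_all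
    rw [kirchhoff_twig heT, extend_of_ne _ (by rcases hk with h | h <;> simp [h]), zero_sub,
      neg_eq_zero]
    refine Finset.sum_eq_zero fun r _ => ?_
    by_cases hr : c.kind r = Kind.cap
    · rw [hT.kron_cap_eq_zero r ⟨e, heT⟩ hr hk, zero_mul]
    · rw [extend_of_ne _ hr, mul_zero]
  · have hk : c.kind e = Kind.cap ∨ c.kind e = Kind.diss := by
      cases h : c.kind e <;> simp_all
    rw [kirchhoff_link heT, extend_of_ne _ (by rcases hk with h | h <;> simp [h]), zero_add]
    refine Finset.sum_eq_zero fun s _ => ?_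
    by_cases hs : c.kind s = Kind.ind
    · rcases hk with hk | hk
      · rw [hT.kron_cap_eq_zero ⟨e, heT⟩ s hk (Or.inr hs), zero_mul]
      · rw [hT.kron_diss_eq_zero ⟨e, heT⟩ s hk hs, zero_mul]
    · rw [extend_of_ne _ hs, mul_zero]

lemma algebraicPart_derivativePart (hT : c.IsNormalTree T) (p : c.State) :
    c.algebraicPart T (c.derivativePart T p) = 0 := by
  funext e
  rw [algebraicPart_apply]
  split_ifs with he
  · exact derivativePart_of_isAlgebraic hT p he
  · rfl

lemma exists_derivativePart_eq (hT : c.IsNormalTree T) {y : c.NonSource → ℝ}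
    (hy : c.algebraicPart T y = 0) : ∃ p, c.derivativePart T p = y := by
  -- Zero velocities on capacitor links and inductor twigs make the sums with `F` vanish in the
  -- differential rows, which then read off the remaining velocities.
  refine ⟨(fun e => if e.1 ∈ T then y ⟨e, by simp [e.2]⟩ else 0,
    fun e => if e.1 ∈ T then 0 else y ⟨e, by simp [e.2]⟩, 0), funext fun e => ?_⟩
  by_cases he : c.IsAlgebraic T e
  · have := congrFun hy e
    rw [algebraicPart_apply, if_pos he] at this
    rw [derivativePart_of_isAlgebraic hT _ he, this]
    rfl
  · obtain ⟨e, hV, hI⟩ := e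
    rw [derivativePart_apply]
    rcases not_not.1 he with ⟨hk, heT⟩ | ⟨hk, heT⟩
    · rw [kirchhoff_twig heT, extend_of_eq _ hk, Finset.sum_eq_zero, sub_zero]
      · exact if_pos heT
      · intro r _
        by_cases hr : c.kind r = Kind.cap
        · rw [extend_of_eq _ hr]
          exact mul_eq_zero_of_right _ (if_neg r.2)
        · rw [extend_of_ne _ hr, mul_zero]
    · rw [kirchhoff_link heT, extend_of_eq _ hk, Finset.sum_eq_zero, add_zero]
      · exact if_neg heT
      · intro r _
        by_cases hr : c.kind r = Kind.ind
        · rw [extend_of_eq _ hr]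
          exact mul_eq_zero_of_right _ (if_pos r.2)
        · rw [extend_of_ne _ hr, mul_zero]

/-- Kirchhoff's laws for a circuit whose capacitor charges, inductor fluxes and dissipators have
the velocities `a`, `b`, `(i, v)`: the powers of the three groups of elements vanish. -/
lemma dotProduct_eq_zero_of_kirchhoff {a a' : c.Edge Kind.cap → ℝ} {b b' : c.Edge Kind.ind → ℝ}
    {i v : c.Edge Kind.diss → ℝ}
    (h0 : ∀ e : c.NonSource, c.kirchhoff T (c.extend Kind.cap a) (c.extend Kind.ind b) e = 0)
    (h1 : ∀ e : c.NonSource, c.IsAlgebraic T e →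
      c.kirchhoff T (c.extend Kind.diss i + c.extend Kind.ind b')
        (c.extend Kind.cap a' + c.extend Kind.diss v) e = 0) :
    a ⬝ᵥ a' = 0 ∧ b ⬝ᵥ b' = 0 ∧ (a' = 0 → b' = 0 → i ⬝ᵥ v = 0) := by
  set i₁ := c.extend Kind.diss i + c.extend Kind.ind b' with hi₁
  set v₁ := c.extend Kind.cap a' + c.extend Kind.diss v with hv₁
  have hki : ∀ e, i₁ e ≠ 0 → c.kind e = Kind.diss ∨ c.kind e = Kind.ind := by
    intro e he
    by_contra! hcon
    exact he (by simp [hi₁, extend_of_ne _ hcon.1, extend_of_ne _ hcon.2])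
  have hkv : ∀ e, v₁ e ≠ 0 → c.kind e = Kind.cap ∨ c.kind e = Kind.diss := by
    intro e he
    by_contra! hcon
    exact he (by simp [hv₁, extend_of_ne _ hcon.1, extend_of_ne _ hcon.2])
  refine ⟨?_, ?_, ?_⟩
  · have h := sum_current_mul_voltage_eq_zero (c := c) (T := T) (i := c.extend Kind.cap a)
      (v := v₁) ?_ ?_
    · rw [sum_extend_mul] at h
      rw [← h]
      congr 1
      funext e
      simp [hv₁, extend_of_eq _ e.2, extend_of_ne v (show c.kind e ≠ Kind.diss by simp [e.2])]
    · intro e he hv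
      have hk : c.kind e ≠ Kind.vsrc ∧ c.kind e ≠ Kind.isrc := by
        rcases hkv e hv with h | h <;> simp [h]
      exact (kirchhoff_twig he).trans ((kirchhoff_twig he).symm.trans (h0 ⟨e, hk⟩))
    · intro e he hi
      have hk := kind_eq_of_extend_ne_zero hi
      exact (kirchhoff_link he).trans ((kirchhoff_link he).symm.trans
        (h1 ⟨e, by simp [hk]⟩ (by simp [IsAlgebraic, hk, he])))
  -- The dual pairing: currents from `h1`, voltages from `h0`; twigs carrying voltage are inductors,
  -- whose rows are algebraic.
  · have h := sum_current_mul_voltage_eq_zero (c := c) (T := T) (i := i₁)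
      (v := c.extend Kind.ind b) ?_ ?_
    · simp only [mul_comm (i₁ _)] at h
      rw [sum_extend_mul] at h
      rw [← h]
      congr 1
      funext e
      simp [hi₁, extend_of_eq _ e.2, extend_of_ne i (show c.kind e ≠ Kind.diss by simp [e.2])]
    · intro e he hv
      have hk := kind_eq_of_extend_ne_zero hv
      exact (kirchhoff_twig he).trans ((kirchhoff_twig he).symm.trans
        (h1 ⟨e, by simp [hk]⟩ (by simp [IsAlgebraic, hk, he])))
    · intro e he hi
      have hk : c.kind e ≠ Kind.vsrc ∧ c.kind e ≠ Kind.isrc := by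
        rcases hki e hi with h | h <;> simp [h]
      exact (kirchhoff_link he).trans ((kirchhoff_link he).symm.trans (h0 ⟨e, hk⟩))
  -- Only dissipators are left in the second system, and all their rows are algebraic, so `h1` alone
  -- suffices.
  · rintro rfl rfl
    rw [map_zero, add_zero] at hi₁
    rw [map_zero, zero_add] at hv₁
    have h := sum_current_mul_voltage_eq_zero (c := c) (T := T) (i := i₁) (v := v₁) ?_ ?_
    · rw [hi₁, sum_extend_mul] at h
      rw [← h]
      congr 1
      funext e
      rw [hv₁, extend_of_eq _ e.2]
    · intro e he hv
      rw [hv₁] at hv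
      have hk := kind_eq_of_extend_ne_zero hv
      exact h1 ⟨e, by simp [hk]⟩ (by simp [IsAlgebraic, hk])
    · intro e he hi
      rw [hi₁] at hi
      have hk := kind_eq_of_extend_ne_zero hi
      exact h1 ⟨e, by simp [hk]⟩ (by simp [IsAlgebraic, hk])

/-- Along a mixed form, velocities of the dissipators without power vanish. -/
lemma IsMixedForm.eq_zero_of_dotProduct {G : Finset (c.Edge Kind.diss)}
    {Ω : Set (c.Edge Kind.diss → ℝ)} {ρ : (c.Edge Kind.diss → ℝ) → (c.Edge Kind.diss → ℝ)}
    (hρ : c.IsMixedForm G Ω ρ) (hc : c.Assumptions T) {y : c.Edge Kind.diss → ℝ} (hy : y ∈ Ω)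
    {w : c.Edge Kind.diss → ℝ}
    (hw : mix G w (fderiv ℝ ρ y w) ⬝ᵥ mix G (fderiv ℝ ρ y w) w = 0) : w = 0 := by
  set R := fun z : (c.Edge Kind.diss → ℝ) × (c.Edge Kind.diss → ℝ) => c.dissRel z.1 z.2 with hR
  set m := fun y : c.Edge Kind.diss → ℝ => (mix G y (ρ y), mix G (ρ y) y) with hm
  -- The curve-free form of passivity: `m` parametrises zeros of `R`, so differentiating `R ∘ m = 0`
  -- along `w` puts `(i', v')` into the kernel of the pair of partial Jacobians.
  have hzero : ∀ y ∈ Ω, R (m y) = 0 := fun y hy => by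
    refine (hρ.represents y hy).self_of_nhds.2 ?_
    change mix G (mix G (ρ y) y) (mix G y (ρ y)) = ρ (mix G (mix G y (ρ y)) (mix G (ρ y) y))
    rw [mix_mix, mix_mix]
  have hρd : HasFDerivAt ρ (fderiv ℝ ρ y) y :=
    ((hρ.smooth.differentiableOn one_ne_zero).differentiableAt
      (hρ.isOpen.mem_nhds hy)).hasFDerivAt
  have hmd : HasFDerivAt m
      (((mixL G).comp ((ContinuousLinearMap.id ℝ _).prod (fderiv ℝ ρ y))).prod
        ((mixL G).comp ((fderiv ℝ ρ y).prod (ContinuousLinearMap.id ℝ _)))) y :=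
    ((mixL G).hasFDerivAt.comp y ((hasFDerivAt_id y).prodMk hρd)).prodMk
      ((mixL G).hasFDerivAt.comp y (hρd.prodMk (hasFDerivAt_id y)))
  have hRd : HasFDerivAt R (fderiv ℝ R (m y)) (m y) :=
    (hc.diss_smooth.differentiable one_ne_zero _).hasFDerivAt
  have hcomp := hRd.comp y hmd
  have hderiv0 : HasFDerivAt (R ∘ m) (0 : (c.Edge Kind.diss → ℝ) →L[ℝ] _) y :=
    (hasFDerivAt_const 0 y).congr_of_eventuallyEq
      (Filter.eventually_of_mem (hρ.isOpen.mem_nhds hy) hzero)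
  have happ := DFunLike.congr_fun (hcomp.unique hderiv0) w
  set i' := mix G w (fderiv ℝ ρ y w) with hi'
  set v' := mix G (fderiv ℝ ρ y w) w with hv'
  change fderiv ℝ R (m y) (i', v') = 0 at happ
  have h1 : HasFDerivAt (fun i => c.dissRel i (m y).2)
      ((fderiv ℝ R (m y)).comp (ContinuousLinearMap.inl ℝ _ _)) (m y).1 :=
    HasFDerivAt.comp (g := R) (f := fun i => (i, (m y).2)) (m y).1 hRd
      (hasFDerivAt_prodMk_left (m y).1 (m y).2)
  have h2 : HasFDerivAt (fun v => c.dissRel (m y).1 v)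
      ((fderiv ℝ R (m y)).comp (ContinuousLinearMap.inr ℝ _ _)) (m y).2 :=
    HasFDerivAt.comp (g := R) (f := fun v => ((m y).1, v)) (m y).2 hRd
      (hasFDerivAt_prodMk_right (m y).1 (m y).2)
  by_contra hne
  refine (hc.diss_passive _ _ (hzero y hy) i' v' ?_ ?_).ne' hw
  · by_contra! hcon
    refine hne ?_
    rw [← mix_mix G w (fderiv ℝ ρ y w), ← hi', ← hv', hcon.1, hcon.2]
    funext j
    simp [mix]
  · rw [jacobian_mulVec h1.differentiableAt, jacobian_mulVec h2.differentiableAt, h1.fderiv,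
      h2.fderiv, ← happ]
    simp [← map_add]

/-- The dimension of the state space is the number of equations. -/
lemma finrank_state :
    Module.finrank ℝ c.State = Module.finrank ℝ (c.NonSource → ℝ) := by
  have hcard : ∀ k, Fintype.card (c.Edge k) = (Finset.univ.filter fun e => c.kind e = k).card :=
    fun k => Fintype.card_subtype _
  rw [Module.finrank_prod, Module.finrank_prod, Module.finrank_fintype_fun_eq_card,
    Module.finrank_fintype_fun_eq_card, Module.finrank_fintype_fun_eq_card,
    Module.finrank_fintype_fun_eq_card, hcard, hcard, hcard, Fintype.card_subtype,
    ← Finset.card_union_of_disjoint, ← Finset.card_union_of_disjoint]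
  · congr 1
    ext e
    cases h : c.kind e <;> simp [h]
  · simp only [← Finset.filter_or]
    exact Finset.disjoint_filter.2 fun e _ h1 h2 => by simp [h1] at h2
  · exact Finset.disjoint_filter.2 fun e _ h1 h2 => by simp [h1] at h2

/-! ### The state equation as static part plus derivative part -/

section StateEquation

variable (c T) (G : Finset (c.Edge Kind.diss))
  (ρ : (c.Edge Kind.diss → ℝ) → (c.Edge Kind.diss → ℝ))

/-- The currents that do not involve the derivatives. -/
def staticCurrent (z : ℝ × c.State) : E → ℝ :=
  c.extend Kind.diss (mix G z.2.2.2 (ρ z.2.2.2)) + c.extend Kind.ind (pderiv c.indEnergy z.2.2.1)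
    + c.extend Kind.isrc (c.iSource z.1)

/-- The voltages that do not involve the derivatives. -/
def staticVoltage (z : ℝ × c.State) : E → ℝ :=
  c.extend Kind.cap (pderiv c.capEnergy z.2.1) + c.extend Kind.diss (mix G (ρ z.2.2.2) z.2.2.2)
    + c.extend Kind.vsrc (c.vSource z.1)

/-- The part of the state equation that does not involve the derivatives. -/
def staticPart (z : ℝ × c.State) : c.NonSource → ℝ :=
  c.kirchhoffL T (c.staticCurrent G ρ z, c.staticVoltage G ρ z)

lemma current_eq (t : ℝ) (x p : c.State) :
    c.current G ρ t x p = c.staticCurrent G ρ (t, x) + c.extend Kind.cap p.1 := by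
  funext e
  simp only [staticCurrent, Pi.add_apply]
  unfold current
  split <;> rename_i h <;> simp [extend, h]

lemma voltage_eq (t : ℝ) (x p : c.State) :
    c.voltage G ρ t x p = c.staticVoltage G ρ (t, x) + c.extend Kind.ind p.2.1 := by
  funext e
  simp only [staticVoltage, Pi.add_apply]
  unfold voltage
  split <;> rename_i h <;> simp [extend, h]

lemma stateEq_eq (t : ℝ) (x p : c.State) :
    c.stateEq T G ρ t x p = c.staticPart T G ρ (t, x) + c.derivativePart T p := by
  change c.kirchhoffL T (c.current G ρ t x p, c.voltage G ρ t x p) = _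
  rw [current_eq, voltage_eq, ← Prod.mk_add_mk, map_add]
  rfl

variable {c T G ρ} {Ω : Set (c.Edge Kind.diss → ℝ)} {I : Set ℝ}

lemma isOpen_stateDomain (hΩ : IsOpen Ω) : IsOpen (c.stateDomain Ω) :=
  hΩ.preimage (continuous_snd.comp continuous_snd)

lemma contDiffOn_staticPart (hc : c.Assumptions T) (hV : ContDiffOn ℝ 1 c.vSource I)
    (hJ : ContDiffOn ℝ 1 c.iSource I) (hρ : c.IsMixedForm G Ω ρ) :
    ContDiffOn ℝ 1 (c.staticPart T G ρ) (I ×ˢ c.stateDomain Ω) := by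
  have hy : ContDiffOn ℝ 1 (fun z : ℝ × c.State => z.2.2.2) (I ×ˢ c.stateDomain Ω) :=
    ContDiff.contDiffOn (by fun_prop)
  have hρ' : ContDiffOn ℝ 1 (fun z : ℝ × c.State => ρ z.2.2.2) (I ×ˢ c.stateDomain Ω) :=
    hρ.smooth.comp hy fun z hz => hz.2
  have hV' : ContDiffOn ℝ 1 (fun z : ℝ × c.State => c.vSource z.1) (I ×ˢ c.stateDomain Ω) :=
    hV.comp contDiff_fst.contDiffOn fun z hz => hz.1
  have hJ' : ContDiffOn ℝ 1 (fun z : ℝ × c.State => c.iSource z.1) (I ×ˢ c.stateDomain Ω) :=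
    hJ.comp contDiff_fst.contDiffOn fun z hz => hz.1
  have hq : ContDiffOn ℝ 1 (fun z : ℝ × c.State => pderiv c.capEnergy z.2.1)
      (I ×ˢ c.stateDomain Ω) :=
    ((contDiff_pderiv hc.cap_smooth).comp (by fun_prop)).contDiffOn
  have hφ : ContDiffOn ℝ 1 (fun z : ℝ × c.State => pderiv c.indEnergy z.2.2.1)
      (I ×ˢ c.stateDomain Ω) :=
    ((contDiff_pderiv hc.ind_smooth).comp (by fun_prop)).contDiffOn
  exact (c.kirchhoffL T).contDiff.comp_contDiffOn <| ContDiffOn.prodMk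
    ((((c.extend _).contDiff.comp_contDiffOn
      ((mixL G).contDiff.comp_contDiffOn (hy.prodMk hρ'))).add
      ((c.extend _).contDiff.comp_contDiffOn hφ)).add ((c.extend _).contDiff.comp_contDiffOn hJ'))
    ((((c.extend _).contDiff.comp_contDiffOn hq).add ((c.extend _).contDiff.comp_contDiffOn
      ((mixL G).contDiff.comp_contDiffOn (hρ'.prodMk hy)))).add
      ((c.extend _).contDiff.comp_contDiffOn hV'))

/-- The derivative of the static part in the directions of the state space. -/
lemma fderivWithin_staticPart (hc : c.Assumptions T) (hV : ContDiffOn ℝ 1 c.vSource I)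
    (hJ : ContDiffOn ℝ 1 c.iSource I) (hρ : c.IsMixedForm G Ω ρ) {t : ℝ} (ht : t ∈ I)
    {x : c.State} (hx : x ∈ c.stateDomain Ω) (p : c.State) :
    fderivWithin ℝ (c.staticPart T G ρ) (I ×ˢ c.stateDomain Ω) (t, x) (0, p)
      = c.kirchhoffL T
        (c.extend Kind.diss (mix G p.2.2 (fderiv ℝ ρ x.2.2 p.2.2))
            + c.extend Kind.ind ((hessian c.indEnergy x.2.1).mulVec p.2.1),
          c.extend Kind.cap ((hessian c.capEnergy x.1).mulVec p.1)
            + c.extend Kind.diss (mix G (fderiv ℝ ρ x.2.2 p.2.2) p.2.2)) := by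
  have hU := isOpen_stateDomain (c := c) hρ.isOpen
  -- Freezing `t` turns the derivative within `I ×ˢ c.stateDomain Ω` into an ordinary one, since the
  -- state domain is open; the sources become constants.
  have hslice : HasFDerivAt (fun x => c.staticPart T G ρ (t, x))
      ((fderivWithin ℝ (c.staticPart T G ρ) (I ×ˢ c.stateDomain Ω) (t, x)).comp
        (ContinuousLinearMap.inr ℝ ℝ c.State)) x := by
    have h1 := ((contDiffOn_staticPart hc hV hJ hρ).differentiableOn one_ne_zero (t, x)
      ⟨ht, hx⟩).hasFDerivWithinAt
    have h2 : MapsTo (fun x : c.State => (t, x)) (c.stateDomain Ω) (I ×ˢ c.stateDomain Ω) :=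
      fun x hx => ⟨ht, hx⟩
    exact (h1.comp x (hasFDerivAt_prodMk_right t x).hasFDerivWithinAt h2).hasFDerivAt
      (hU.mem_nhds hx)
  have hid := hasFDerivAt_id (𝕜 := ℝ) x
  have hy := hid.snd.snd
  have hφ := hid.snd.fst
  have hq := hid.fst
  have hρd : HasFDerivAt ρ (fderiv ℝ ρ x.2.2) x.2.2 :=
    ((hρ.smooth.differentiableOn one_ne_zero).differentiableAt
      (hρ.isOpen.mem_nhds hx)).hasFDerivAt
  have hρy := HasFDerivAt.comp (g := ρ) x hρd hy
  have hφ' := HasFDerivAt.comp x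
    ((contDiff_pderiv hc.ind_smooth).differentiable one_ne_zero x.2.1).hasFDerivAt hφ
  have hq' := HasFDerivAt.comp x
    ((contDiff_pderiv hc.cap_smooth).differentiable one_ne_zero x.1).hasFDerivAt hq
  have hcur := ((((c.extend Kind.diss).hasFDerivAt.comp x
    ((mixL G).hasFDerivAt.comp x (hy.prodMk hρy))).add
    ((c.extend Kind.ind).hasFDerivAt.comp x hφ')).add_const (c.extend Kind.isrc (c.iSource t)))
  have hvol := ((((c.extend Kind.cap).hasFDerivAt.comp x hq').add
    ((c.extend Kind.diss).hasFDerivAt.comp x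
      ((mixL G).hasFDerivAt.comp x (hρy.prodMk hy)))).add_const
      (c.extend Kind.vsrc (c.vSource t)))
  have hall := (c.kirchhoffL T).hasFDerivAt.comp x (hcur.prodMk hvol)
  have h := DFunLike.congr_fun (hslice.unique hall) p
  rw [← fderiv_pderiv hc.ind_smooth, ← fderiv_pderiv hc.cap_smooth]
  exact h

/-- The state equation with differentiated algebraic rows determines `x'`. -/
lemma eq_zero_of_derivativePart_eq_zero (hc : c.Assumptions T)
    (hV : ContDiffOn ℝ 1 c.vSource I) (hJ : ContDiffOn ℝ 1 c.iSource I)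
    (hρ : c.IsMixedForm G Ω ρ) {t : ℝ} (ht : t ∈ I) {x : c.State} (hx : x ∈ c.stateDomain Ω)
    {p : c.State} (hp : c.derivativePart T p = 0)
    (hp' : c.algebraicPart T
      (fderivWithin ℝ (c.staticPart T G ρ) (I ×ˢ c.stateDomain Ω) (t, x) (0, p)) = 0) :
    p = 0 := by
  rw [fderivWithin_staticPart hc hV hJ hρ ht hx] at hp'
  obtain ⟨hq, hφ, hy⟩ := dotProduct_eq_zero_of_kirchhoff (fun e => congrFun hp e)
    fun e he => by
      have := congrFun hp' e
      rwa [algebraicPart_apply, if_pos he] at this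
  -- The linearised capacitor voltage is the Hessian applied to `p.1`, so the vanishing pairing is
  -- its quadratic form; likewise for `p.2.1`.
  have hq0 : p.1 = 0 := (hc.cap_hessian _).eq_zero hq
  have hφ0 : p.2.1 = 0 := (hc.ind_hessian _).eq_zero hφ
  have hy0 : p.2.2 = 0 := hρ.eq_zero_of_dotProduct hc hx
    (hy (by rw [hq0, Matrix.mulVec_zero]) (by rw [hφ0, Matrix.mulVec_zero]))
  exact Prod.ext hq0 (Prod.ext hφ0 hy0)

end StateEquation

end Circuit

end CpH

end

theorem theorem4p8 {V E : Type*} [Fintype V] [DecidableEq V] [Fintype E] [DecidableEq E]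
    (c : CpH.Circuit V E) (T : Finset E) (hc : c.Assumptions T)
    (I : Set ℝ) (hI : I.OrdConnected) (hI' : (interior I).Nonempty)
    (hV : ContDiffOn ℝ 1 c.vSource I) (hJ : ContDiffOn ℝ 1 c.iSource I)
    (G : Finset (c.Edge CpH.Kind.diss)) (Ω : Set (c.Edge CpH.Kind.diss → ℝ))
    (ρ : (c.Edge CpH.Kind.diss → ℝ) → (c.Edge CpH.Kind.diss → ℝ))
    (hρ : c.IsMixedForm G Ω ρ) :
    (c.nLink T CpH.Kind.cap = 0 ∧ c.nTwig T CpH.Kind.ind = 0 ∧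
        c.nTwig T CpH.Kind.diss = 0 ∧ c.nLink T CpH.Kind.diss = 0 →
      DAE.IsODE (c.stateEq T G ρ) I (c.stateDomain Ω)) ∧
    (¬ (c.nLink T CpH.Kind.cap = 0 ∧ c.nTwig T CpH.Kind.ind = 0 ∧
        c.nTwig T CpH.Kind.diss = 0 ∧ c.nLink T CpH.Kind.diss = 0) →
      (∃ t ∈ I, ∃ x ∈ c.stateDomain Ω, ∃ p, c.stateEq T G ρ t x p = 0) →
      DAE.HasDifferentiationIndex (c.stateEq T G ρ) I (c.stateDomain Ω) 1) := by
  have hsmooth := CpH.Circuit.contDiffOn_staticPart hc hV hJ hρ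
  rw [CpH.Circuit.forall_not_isAlgebraic_iff]
  constructor
  · intro halg
    refine DAE.isODE_of_surjective CpH.Circuit.finrank_state (c.stateEq_eq T G ρ)
      hsmooth.continuousOn fun y => CpH.Circuit.exists_derivativePart_eq hc.normal ?_
    funext e
    rw [CpH.Circuit.algebraicPart_apply, if_neg (halg e)]
    rfl
  · intro halg hcons
    push Not at halg
    obtain ⟨e, he⟩ := halg
    refine DAE.hasDifferentiationIndex_one CpH.Circuit.finrank_state (c.stateEq_eq T G ρ)
      (uniqueDiffOn_convex hI.convex hI') (CpH.Circuit.isOpen_stateDomain hρ.isOpen) hsmooth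
      CpH.Circuit.algebraicPart_algebraicPart
      (CpH.Circuit.algebraicPart_derivativePart hc.normal)
      (fun y hy => CpH.Circuit.exists_derivativePart_eq hc.normal hy) ?_
      (fun z hz p => CpH.Circuit.eq_zero_of_derivativePart_eq_zero hc hV hJ hρ hz.1 hz.2) hcons
    -- A single algebraic row makes the projection nonzero, as the constant vector `1` shows.
    intro hP
    have h := congrFun (DFunLike.congr_fun hP fun _ => (1 : ℝ)) e
    rw [CpH.Circuit.algebraicPart_apply, if_pos he] at h
    exact one_ne_zero h
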